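/- All rings are associative with identity, and ring homomorphisms preserve the identity. Let $R$ and $Q$ be (not necessarily commutative) rings and let $\varphi\colon R\to Q$ be a bimorphism in the category of rings, i.e., $\varphi$ is both a monomorphism and an epimorphism; view $R$ as a subring of $Q$ via $\varphi$. Assume that $Q$ is flat as a left $R$-module. A left $R$-module $C$ is called \emph{Matlis-cotorsion} if $\operatorname{Ext}^1_R({}_RQ,C)=0$, and a left $R$-module $S$ is called \emph{strongly flat} if $\operatorname{Ext}^1_R(S,C)=0$ for every Matlis-cotorsion left $R$-module $C$. A \emph{strongly flat cover} of a left $R$-module $M$ is an $R$-homomorphism $f\colon S\to M$ with $S$ strongly flat such that (i) for every strongly flat left $R$-module $S'$, every $R$-homomorphism $f'\colon S'\to M$ has the form $f'=f\circ g$ for some $R$-homomorphism $g\colon S'\to S$; and (ii) every endomorphism $g$ of $S$ with $f\circ g=f$ is an automorphism. \textbf{Theorem.} If every left $Q$-module, viewed as a left $R$-module, has a strongly flat cover, then $Q$ is left perfect, i.e., every left $Q$-module has a projective cover (a surjective $Q$-homomorphism from a projective left $Q$-module whose kernel is a superfluous submodule). -/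

import Mathlib

open CategoryTheory MulOpposite
open scoped TensorProduct

universe u

namespace NCModule

section Tensor

variable (R : Type u) [Ring R]

/-- The subgroup of `N ⊗[ℤ] M` generated by all `(n r) ⊗ m - n ⊗ (r m)`, for a right `R`-module `N`
(a module over the opposite ring) and a left `R`-module `M`. -/
def balancedRelations (N M : Type u) [AddCommGroup N] [Module Rᵐᵒᵖ N] [AddCommGroup M]
    [Module R M] : AddSubgroup (N ⊗[ℤ] M) :=
  AddSubgroup.closure
    {z | ∃ (n : N) (r : R) (m : M), z = (op r • n) ⊗ₜ[ℤ] m - n ⊗ₜ[ℤ] (r • m)}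

/-- The tensor product `N ⊗_R M` of a right `R`-module `N` and a left `R`-module `M` over a ring `R`
that need not be commutative; it is an abelian group. -/
abbrev Tensor (N M : Type u) [AddCommGroup N] [Module Rᵐᵒᵖ N] [AddCommGroup M]
    [Module R M] : Type u :=
  (N ⊗[ℤ] M) ⧸ balancedRelations R N M

variable {R}

theorem balancedRelations_le_comap {N N' : Type u} [AddCommGroup N] [Module Rᵐᵒᵖ N]
    [AddCommGroup N'] [Module Rᵐᵒᵖ N'] (f : N →ₗ[Rᵐᵒᵖ] N')
    (M : Type u) [AddCommGroup M] [Module R M] :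
    balancedRelations R N M ≤ (balancedRelations R N' M).comap
      (LinearMap.rTensor M f.toAddMonoidHom.toIntLinearMap).toAddMonoidHom := by
  refine (AddSubgroup.closure_le _).2 ?_
  rintro _ ⟨n, r, m, rfl⟩
  refine AddSubgroup.subset_closure ⟨f n, r, m, ?_⟩
  simp [map_sub]

/-- The homomorphism `f ⊗ 1 : N ⊗_R M → N' ⊗_R M` induced by a homomorphism `f : N → N'` of right
`R`-modules. -/
def Tensor.map {N N' : Type u} [AddCommGroup N] [Module Rᵐᵒᵖ N]
    [AddCommGroup N'] [Module Rᵐᵒᵖ N'] (f : N →ₗ[Rᵐᵒᵖ] N')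
    (M : Type u) [AddCommGroup M] [Module R M] : Tensor R N M →+ Tensor R N' M :=
  QuotientAddGroup.map _ _
    (LinearMap.rTensor M f.toAddMonoidHom.toIntLinearMap).toAddMonoidHom
    (balancedRelations_le_comap f M)

variable (R)

/-- The left `R`-module `M` is flat: `- ⊗_R M` preserves injectivity of homomorphisms of right
`R`-modules. -/
def IsFlat (M : Type u) [AddCommGroup M] [Module R M] : Prop :=
  ∀ (N N' : Type u) [AddCommGroup N] [Module Rᵐᵒᵖ N] [AddCommGroup N'] [Module Rᵐᵒᵖ N']
    (f : N →ₗ[Rᵐᵒᵖ] N'), Function.Injective f → Function.Injective (Tensor.map f M)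

end Tensor

section Perp

variable {R : Type u} [Ring R]

/-- The class `⊥𝒜` of all left `R`-modules `B` with `Ext¹_R(B, A) = 0` for every `A` in `𝒜`. -/
def leftPerp (𝒜 : ObjectProperty (ModuleCat.{u} R)) : ObjectProperty (ModuleCat.{u} R) :=
  fun B => ∀ A : ModuleCat.{u} R, 𝒜 A → Subsingleton (Abelian.Ext B A 1)

end Perp

section StronglyFlat

variable {R Q : Type u} [Ring R] [Ring Q] (φ : R →+* Q)

/-- A left `Q`-module, viewed as a left `R`-module along `φ : R → Q`. -/
noncomputable abbrev res (M : ModuleCat.{u} Q) : ModuleCat.{u} R :=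
  (ModuleCat.restrictScalars φ).obj M

/-- The left `R`-module `Q`. -/
noncomputable abbrev leftQ : ModuleCat.{u} R := res φ (ModuleCat.of Q Q)

/-- A left `R`-module `M` is Matlis-cotorsion if `Ext¹_R(Q, M) = 0`. -/
def MatlisCotorsion : ObjectProperty (ModuleCat.{u} R) :=
  fun M => Subsingleton (Abelian.Ext (leftQ φ) M 1)

/-- A left `R`-module is strongly flat if it lies in `⊥MC`, where `MC` is the class of
Matlis-cotorsion left `R`-modules. -/
def StronglyFlat : ObjectProperty (ModuleCat.{u} R) :=
  leftPerp (MatlisCotorsion φ)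

end StronglyFlat

section Cover

variable {R : Type u} [Ring R]

/-- `f : S ⟶ M` is a `𝒞`-precover of `M`: `S` is in `𝒞` and every homomorphism to `M` from a
module in `𝒞` factors through `f`. -/
def IsPrecover (𝒞 : ObjectProperty (ModuleCat.{u} R)) {S M : ModuleCat.{u} R} (f : S ⟶ M) : Prop :=
  𝒞 S ∧ ∀ (S' : ModuleCat.{u} R) (f' : S' ⟶ M), 𝒞 S' → ∃ g : S' ⟶ S, g ≫ f = f'

/-- `f : S ⟶ M` is a `𝒞`-cover of `M`: it is a `𝒞`-precover and every endomorphism `g` of `S` with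
`f ∘ g = f` is an automorphism. -/
def IsCover (𝒞 : ObjectProperty (ModuleCat.{u} R)) {S M : ModuleCat.{u} R} (f : S ⟶ M) : Prop :=
  IsPrecover 𝒞 f ∧ ∀ g : S ⟶ S, g ≫ f = f → IsIso g

end Cover

section Perfect

variable (Q : Type u) [Ring Q]

/-- `f : P → M` is a projective cover: `P` is projective, `f` is surjective, and `ker f` is a
superfluous submodule of `P`. -/
def IsProjectiveCover {P M : Type u} [AddCommGroup P] [Module Q P] [AddCommGroup M] [Module Q M]
    (f : P →ₗ[Q] M) : Prop :=
  Module.Projective Q P ∧ Function.Surjective f ∧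
    ∀ H : Submodule Q P, LinearMap.ker f ⊔ H = ⊤ → H = ⊤

/-- The ring `Q` is left perfect: every left `Q`-module has a projective cover. -/
def IsLeftPerfect : Prop :=
  ∀ (M : Type u) [AddCommGroup M] [Module Q M],
    ∃ (P : Type u) (_ : AddCommGroup P) (_ : Module Q P) (f : P →ₗ[Q] M), IsProjectiveCover Q f

end Perfect

end NCModule

namespace NCModule

/-! ### Vanishing of Ext¹ through extending and lifting homomorphisms -/

section Ext

variable {C : Type*} [Category C] [Abelian C] [HasExt.{u} C]

/-! Every left `Q`-module is Matlis-cotorsion over `R` (`subsingleton_ext_leftQ_res`): flatness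
gives this for products of copies of the dual of `Q`, and every `Q`-module embeds in such a product.
So a strongly flat cover `f : S → M` lifts through a free `Q`-module `π : F → M`. Free `Q`-modules
are strongly flat (`stronglyFlat_finsupp`), so `π` also factors through `f`.

By the cover property `S` is then an `R`-summand of `F`. The idempotent onto it is `Q`-linear
because `R → Q` is an epimorphism (`map_smul_of_epi`), so its range is a projective `Q`-module. The
cover property again makes the kernel of its map to `M` superfluous. -/

theorem subsingleton_ext_one_of_exists_extension {S : ShortComplex C} (hS : S.ShortExact)
    [Projective S.X₂] (A : C) (h : ∀ f : S.X₁ ⟶ A, ∃ g : S.X₂ ⟶ A, S.f ≫ g = f) :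
    Subsingleton (Abelian.Ext S.X₃ A 1) := by
  refine subsingleton_of_forall_eq 0 fun x => ?_
  -- Every class is the connecting image of some `S.X₁ ⟶ A`; that image vanishes when the map
  -- extends to `S.X₂`.
  obtain ⟨y, rfl⟩ := Abelian.Ext.contravariant_sequence_exact₃ hS A x
    (Abelian.Ext.eq_zero_of_projective _) (n₀ := 0) rfl
  obtain ⟨f, rfl⟩ := Abelian.Ext.addEquiv₀.symm.surjective y
  obtain ⟨g, rfl⟩ := h f
  simp [← Abelian.Ext.mk₀_comp_mk₀]

theorem subsingleton_ext_one_of_exists_lift {S : ShortComplex C} (hS : S.ShortExact) (B : C)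
    (h₂ : Subsingleton (Abelian.Ext B S.X₂ 1))
    (h : ∀ f : B ⟶ S.X₃, ∃ g : B ⟶ S.X₂, g ≫ S.g = f) :
    Subsingleton (Abelian.Ext B S.X₁ 1) := by
  refine subsingleton_of_forall_eq 0 fun x => ?_
  obtain ⟨y, rfl⟩ := Abelian.Ext.covariant_sequence_exact₁ B hS x (Subsingleton.elim _ _)
    (n₀ := 0) rfl
  obtain ⟨f, rfl⟩ := Abelian.Ext.addEquiv₀.symm.surjective y
  obtain ⟨g, rfl⟩ := h f
  simp [← Abelian.Ext.mk₀_comp_mk₀]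

theorem exists_lift_of_subsingleton_ext_one {S : ShortComplex C} (hS : S.ShortExact) (B : C)
    (h₁ : Subsingleton (Abelian.Ext B S.X₁ 1)) (f : B ⟶ S.X₃) :
    ∃ g : B ⟶ S.X₂, g ≫ S.g = f := by
  obtain ⟨y, hy⟩ := Abelian.Ext.covariant_sequence_exact₃ B hS (Abelian.Ext.mk₀ f)
    (n₁ := 1) rfl (Subsingleton.elim _ _)
  obtain ⟨g, rfl⟩ := Abelian.Ext.addEquiv₀.symm.surjective y
  refine ⟨g, Abelian.Ext.addEquiv₀.symm.injective ?_⟩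
  simpa [← Abelian.Ext.mk₀_comp_mk₀] using hy

end Ext

/-! ### Linearity along ring epimorphisms -/

section Epimorphism

variable {R Q : Type u} [Ring R] [Ring Q] (φ : R →+* Q)

/-- The ring homomorphism given by the `Q`-action on `A × B`, twisted by the automorphism
`(a, b) ↦ (a, b + f a)`. -/
def shearedAction {A B : Type u} [AddCommGroup A] [AddCommGroup B] [Module Q A] [Module Q B]
    (f : A →+ B) : Q →+* AddMonoid.End (A × B) where
  toFun q :=
    { toFun := fun x => (q • x.1, q • (x.2 - f x.1) + f (q • x.1))
      map_zero' := by simp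
      map_add' := fun x y => by
        ext
        · simp
        · simp only [Prod.fst_add, Prod.snd_add, map_add, smul_add, smul_sub]; abel }
  map_one' := AddMonoidHom.ext fun x => Prod.ext (one_smul Q x.1) <| by
    change (1 : Q) • (x.2 - f x.1) + f ((1 : Q) • x.1) = x.2
    simp
  map_zero' := AddMonoidHom.ext fun x => Prod.ext (zero_smul Q x.1) <| by
    change (0 : Q) • (x.2 - f x.1) + f ((0 : Q) • x.1) = 0
    simp
  map_mul' p q := AddMonoidHom.ext fun x => Prod.ext (mul_smul p q x.1) <| by
    change (p * q) • (x.2 - f x.1) + f ((p * q) • x.1) =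
      p • (q • (x.2 - f x.1) + f (q • x.1) - f (q • x.1)) + f (p • q • x.1)
    simp [mul_smul]
  map_add' p q := AddMonoidHom.ext fun x => Prod.ext (add_smul p q x.1) <| by
    change (p + q) • (x.2 - f x.1) + f ((p + q) • x.1) =
      p • (x.2 - f x.1) + f (p • x.1) + (q • (x.2 - f x.1) + f (q • x.1))
    rw [add_smul, add_smul, map_add]
    abel

/-- The diagonal action on `A × B` and its conjugate by the shear of `f` agree on `R`, as `f` is
`R`-linear, hence on `Q`. Comparing them at `(a, 0)` gives the claim. -/
theorem map_smul_of_epi (hepi : Epi (RingCat.ofHom φ)) {A B : Type u} [AddCommGroup A]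
    [AddCommGroup B] [Module Q A] [Module Q B] (f : A →+ B)
    (hf : ∀ (r : R) (a : A), f (φ r • a) = φ r • f a) (q : Q) (a : A) : f (q • a) = q • f a := by
  have h : RingCat.ofHom (shearedAction (Q := Q) f) =
      RingCat.ofHom (shearedAction (Q := Q) (0 : A →+ B)) := by
    rw [← cancel_epi (RingCat.ofHom φ)]
    refine RingCat.hom_ext (RingHom.ext fun r => AddMonoidHom.ext fun x => Prod.ext rfl ?_)
    change φ r • (x.2 - f x.1) + f (φ r • x.1) =
      φ r • (x.2 - (0 : A →+ B) x.1) + (0 : A →+ B) (φ r • x.1)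
    simp [hf, smul_sub]
  have h' : q • (0 - f a) + f (q • a) = q • (0 - (0 : A →+ B) a) + (0 : A →+ B) (q • a) :=
    congrArg Prod.snd (DFunLike.congr_fun (RingHom.congr_fun (congrArg RingCat.Hom.hom h) q) (a, 0))
  simp only [zero_sub, smul_neg, AddMonoidHom.zero_apply, sub_zero, smul_zero, add_zero] at h'
  exact (neg_add_eq_zero.1 h').symm

end Epimorphism

/-! ### Character modules of flat modules -/

section Flat

variable {R : Type u} [Ring R]

/-- The right `R`-module structure `(c r)(m) = c (r m)` on the character module of a left
`R`-module. -/
instance characterModuleOp (M : Type u) [AddCommGroup M] [Module R M] :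
    Module Rᵐᵒᵖ (CharacterModule M) where
  smul r c := AddMonoidHom.comp c (DistribSMul.toAddMonoidHom M r.unop)
  one_smul c := CharacterModule.ext _ fun m => congrArg c (one_smul R m)
  mul_smul r s c := CharacterModule.ext _ fun m => congrArg c (mul_smul s.unop r.unop m)
  smul_zero _ := rfl
  smul_add _ _ _ := rfl
  add_smul r s c := CharacterModule.ext _ fun m =>
    (congrArg c (add_smul r.unop s.unop m)).trans (map_add c _ _)
  zero_smul c := CharacterModule.ext _ fun m => (congrArg c (zero_smul R m)).trans (map_zero c)

theorem op_smul_character_apply {M : Type u} [AddCommGroup M] [Module R M] (r : R)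
    (c : CharacterModule M) (m : M) : (op r • c) m = c (r • m) := rfl

/-- The dual of a homomorphism of left `R`-modules, as a homomorphism of right `R`-modules. -/
def dualMap {M N : Type u} [AddCommGroup M] [Module R M] [AddCommGroup N] [Module R N]
    (f : M →ₗ[R] N) : CharacterModule N →ₗ[Rᵐᵒᵖ] CharacterModule M where
  toFun c := AddMonoidHom.comp c f.toAddMonoidHom
  map_add' _ _ := rfl
  map_smul' r c := CharacterModule.ext _ fun m => congrArg c (f.map_smul r.unop m).symm

/-- The additive map `N ⊗_R F → ℚ/ℤ` given by a homomorphism from `N` to the dual of `F`. -/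
noncomputable def tensorCharacter {N F : Type u} [AddCommGroup N] [Module Rᵐᵒᵖ N] [AddCommGroup F]
    [Module R F] (g : N →ₗ[Rᵐᵒᵖ] CharacterModule F) : Tensor R N F →+ AddCircle (1 : ℚ) :=
  QuotientAddGroup.lift _
    (TensorProduct.liftAddHom (R := ℤ) (M := N) (N := F) (P := AddCircle (1 : ℚ)) g.toAddMonoidHom
      fun z n m => by
        change g (z • n) m = g n (z • m)
        rw [map_zsmul, map_zsmul]; rfl) <| by
    refine (AddSubgroup.closure_le _).2 ?_
    rintro _ ⟨n, r, m, rfl⟩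
    refine (map_sub _ _ _).trans (sub_eq_zero.2 ?_)
    change g (op r • n) m = g n (r • m)
    rw [map_smul]; rfl

/-- The dual of a flat module is injective: by tensor-hom adjunction `g` is a character of `N ⊗_R
F`, which extends along the injection into `N' ⊗_R F`. -/
theorem IsFlat.exists_extension_character {F : Type u} [AddCommGroup F] [Module R F]
    (hF : IsFlat R F) {N N' : Type u} [AddCommGroup N] [Module Rᵐᵒᵖ N] [AddCommGroup N']
    [Module Rᵐᵒᵖ N'] (f : N →ₗ[Rᵐᵒᵖ] N') (hf : Function.Injective f)
    (g : N →ₗ[Rᵐᵒᵖ] CharacterModule F) :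
    ∃ g' : N' →ₗ[Rᵐᵒᵖ] CharacterModule F, ∀ n, g' (f n) = g n := by
  obtain ⟨χ, hχ⟩ := CharacterModule.dual_surjective_of_injective
    (Tensor.map f F).toIntLinearMap (hF N N' f hf) (tensorCharacter g)
  have hrel (n : N') (r : R) (m : F) :
      (QuotientAddGroup.mk (((op r • n) ⊗ₜ[ℤ] m : N' ⊗[ℤ] F)) : Tensor R N' F) =
        QuotientAddGroup.mk (n ⊗ₜ[ℤ] (r • m)) := by
    refine (QuotientAddGroup.eq_iff_sub_mem).2 (AddSubgroup.subset_closure ⟨n, r, m, rfl⟩)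
  refine ⟨{ toFun := fun n =>
              { toFun := fun m => χ (QuotientAddGroup.mk (n ⊗ₜ[ℤ] m))
                map_zero' := by rw [TensorProduct.tmul_zero]; exact map_zero χ
                map_add' := fun m m' => by
                  rw [TensorProduct.tmul_add, QuotientAddGroup.mk_add]; exact map_add χ _ _ }
            map_add' := fun n n' => CharacterModule.ext _ fun m => ?_
            map_smul' := fun r n => CharacterModule.ext _ fun m => ?_ }, fun n =>
              CharacterModule.ext _ fun m => ?_⟩
  · change χ (QuotientAddGroup.mk ((n + n') ⊗ₜ[ℤ] m)) = _
    rw [TensorProduct.add_tmul, QuotientAddGroup.mk_add]; exact map_add χ _ _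
  · exact congrArg χ (hrel n r.unop m)
  · exact DFunLike.congr_fun hχ (QuotientAddGroup.mk (n ⊗ₜ[ℤ] m))

/-- This is `Ext¹_R(F, Y*) = 0` in concrete form. The dual sequence splits since `F*` is injective;
transpose `K → Y*` to `Y → K*`, compose with a section `K* → P*`, and transpose back. -/
theorem IsFlat.exists_extension_dual {F K P Y : Type u} [AddCommGroup F] [Module R F]
    (hF : IsFlat R F) [AddCommGroup K] [Module R K] [AddCommGroup P] [Module R P]
    [AddCommGroup Y] [Module Rᵐᵒᵖ Y] (i : K →ₗ[R] P) (p : P →ₗ[R] F)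
    (hi : Function.Injective i) (hip : Function.Exact i p) (hp : Function.Surjective p)
    (g : K →+ CharacterModule Y) (hg : ∀ (r : R) k y, g (r • k) y = g k (op r • y)) :
    ∃ g' : P →+ CharacterModule Y, (∀ (r : R) x y, g' (r • x) y = g' x (op r • y)) ∧
      ∀ k, g' (i k) = g k := by
  have hex : Function.Exact (dualMap p) (dualMap i) := by
    intro c
    constructor
    · intro hc
      have hk : p.toAddMonoidHom.ker ≤ AddMonoidHom.ker (show P →+ AddCircle (1 : ℚ) from c) := by
        intro x hx
        obtain ⟨k, rfl⟩ := (hip x).1 hx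
        exact DFunLike.congr_fun hc k
      refine ⟨AddMonoidHom.liftOfSurjective p.toAddMonoidHom hp ⟨c, hk⟩,
        CharacterModule.ext _ fun x => ?_⟩
      exact AddMonoidHom.liftOfRightInverse_comp_apply _ _ (Function.rightInverse_surjInv hp) ⟨c, hk⟩ x
    · rintro ⟨c, rfl⟩
      refine CharacterModule.ext _ fun k => ?_
      change c (p (i k)) = 0
      rw [hip.apply_apply_eq_zero, map_zero]
  have hpinj : Function.Injective (dualMap p) := fun c c' h => CharacterModule.ext _ fun y => by
    obtain ⟨x, rfl⟩ := hp y
    exact DFunLike.congr_fun h x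
  have hisurj : Function.Surjective (dualMap i) := fun c =>
    CharacterModule.dual_surjective_of_injective i.toAddMonoidHom.toIntLinearMap hi c
  obtain ⟨ρ, hρ⟩ := hF.exists_extension_character (dualMap p) hpinj LinearMap.id
  have hsplit : (Function.Injective (dualMap p) ∧ ∃ l, dualMap i ∘ₗ l = LinearMap.id) ↔
      (Function.Surjective (dualMap i) ∧ ∃ l, l ∘ₗ dualMap p = LinearMap.id) :=
    hex.split_tfae'.out 0 1
  obtain ⟨-, σ, hσ⟩ := hsplit.2 ⟨hisurj, ρ, LinearMap.ext hρ⟩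
  let h₀ : Y →ₗ[Rᵐᵒᵖ] CharacterModule K :=
    { toFun := fun y =>
        { toFun := fun k => g k y
          map_zero' := by rw [map_zero]; rfl
          map_add' := fun k k' => by rw [map_add]; rfl }
      map_add' := fun y y' => CharacterModule.ext _ fun k => map_add (g k) y y'
      map_smul' := fun r y => CharacterModule.ext _ fun k => (hg r.unop k y).symm }
  let h := σ.comp h₀
  refine ⟨{ toFun := fun x =>
              { toFun := fun y => h y x
                map_zero' := by rw [map_zero]; rfl
                map_add' := fun y y' => by rw [map_add]; rfl }
            map_zero' := CharacterModule.ext _ fun y => map_zero (h y)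
            map_add' := fun x x' => CharacterModule.ext _ fun y => map_add (h y) x x' }, ?_, ?_⟩
  · intro r x y
    change h y (r • x) = h (op r • y) x
    rw [h.map_smul, op_smul_character_apply]
  · intro k
    refine CharacterModule.ext _ fun y => ?_
    exact DFunLike.congr_fun (LinearMap.congr_fun hσ (h₀ y)) k

end Flat

/-! ### Matlis-cotorsion and strongly flat modules, and the projective cover -/

section Perpendicular

variable {R Q : Type u} [Ring R] [Ring Q] (φ : R →+* Q)

/-- The dual of the right module `Q`. -/
def RegularDual (Q : Type u) [Ring Q] : Type u := CharacterModule Q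

instance : AddCommGroup (RegularDual Q) := inferInstanceAs (AddCommGroup (CharacterModule Q))

/-- The left action `(q c)(x) = c (x q)`. -/
instance : Module Q (RegularDual Q) where
  smul q c := AddMonoidHom.comp c (AddMonoidHom.mulRight q)
  one_smul (c : CharacterModule Q) := CharacterModule.ext _ fun x => congrArg c (mul_one x)
  mul_smul p q (c : CharacterModule Q) :=
    CharacterModule.ext _ fun x => congrArg c (mul_assoc x p q).symm
  smul_zero _ := rfl
  smul_add _ _ _ := rfl
  add_smul p q (c : CharacterModule Q) := CharacterModule.ext _ fun x =>
    (congrArg c (mul_add x p q)).trans (map_add c _ _)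
  zero_smul (c : CharacterModule Q) := CharacterModule.ext _ fun x =>
    (congrArg c (mul_zero x)).trans (map_zero c)

/-- The embedding of a left `Q`-module into a product of copies of the dual of `Q`. -/
def toRegularDual (N : Type u) [AddCommGroup N] [Module Q N] :
    N →ₗ[Q] (CharacterModule N → RegularDual Q) where
  toFun n c := AddMonoidHom.comp c ((AddMonoidHom.flip (AddMonoidHom.smul (R := Q) (M := N))) n)
  map_add' n n' := funext fun c => CharacterModule.ext _ fun q =>
    (congrArg c (smul_add q n n')).trans (map_add c _ _)
  map_smul' q n := funext fun c => CharacterModule.ext _ fun x => congrArg c (mul_smul x q n).symm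

theorem toRegularDual_injective (N : Type u) [AddCommGroup N] [Module Q N] :
    Function.Injective (toRegularDual (Q := Q) N) := by
  refine (injective_iff_map_eq_zero _).2 fun n hn => ?_
  refine CharacterModule.eq_zero_of_character_apply fun c => ?_
  have h : c ((1 : Q) • n) = 0 := DFunLike.congr_fun (F := CharacterModule Q) (congrFun hn c) (1 : Q)
  rwa [one_smul] at h

theorem subsingleton_ext_regularDual (hflat : IsFlat R (leftQ φ)) (X : Type u) :
    Subsingleton (Abelian.Ext (leftQ φ) (res φ (ModuleCat.of Q (X → RegularDual Q))) 1) := by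
  let S := (leftQ φ).projectiveShortComplex
  have hS : S.ShortExact := (leftQ φ).shortExact_projectiveShortComplex
  have : Projective S.X₂ := (IsProjective.iff_projective (R := R) S.X₂).1 inferInstance
  refine subsingleton_ext_one_of_exists_extension hS _ fun f => ?_
  -- Right multiplication through `φ`, so that `RegularDual Q` is the dual of this right `R`-module.
  let _ : Module Rᵐᵒᵖ Q := Module.compHom Q φ.op
  have key (x : X) := hflat.exists_extension_dual (Y := Q) S.f.hom S.g.hom
    hS.moduleCat_injective_f
    ((ShortComplex.ShortExact.moduleCat_exact_iff_function_exact _).1 hS.exact)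
    hS.moduleCat_surjective_g
    (((Pi.evalAddMonoidHom (fun _ : X => RegularDual Q) x).comp f.hom.toAddMonoidHom :
      S.X₁ →+ RegularDual Q)) (fun r k y => by
        exact DFunLike.congr_fun (F := CharacterModule Q) (congrFun (f.hom.map_smul r k) x) y)
  choose g hg hgf using key
  refine ⟨ModuleCat.ofHom (Y := res φ (ModuleCat.of Q (X → RegularDual Q)))
    { toFun := fun p x => g x p
      map_add' := fun p p' => funext fun x => map_add (g x) p p'
      map_smul' := fun r p => funext fun x => CharacterModule.ext _ fun y => hg x r p y }, ?_⟩
  ext k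
  exact funext fun x => hgf x k

theorem shortExact_res {S : ShortComplex (ModuleCat.{u} Q)} (hS : S.ShortExact) :
    (S.map (ModuleCat.restrictScalars φ)).ShortExact :=
  ModuleCat.shortComplex_shortExact _
    ((ShortComplex.ShortExact.moduleCat_exact_iff_function_exact S).1 hS.exact)
    hS.moduleCat_injective_f hS.moduleCat_surjective_g

variable {φ}

/-- An `R`-homomorphism between `Q`-modules, as a `Q`-homomorphism, for an epimorphism `R → Q`. -/
noncomputable def homOfRes (hepi : Epi (RingCat.ofHom φ)) {A B : ModuleCat.{u} Q} (f : res φ A ⟶ res φ B) :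
    A →ₗ[Q] B where
  toFun a := f.hom a
  map_add' a b := f.hom.map_add a b
  map_smul' q a := map_smul_of_epi φ hepi (A := A) (B := B) f.hom.toAddMonoidHom
    (fun r a => f.hom.map_smul r a) q a

/-- An `R`-map from `Q` to the cokernel of `toRegularDual` is `Q`-linear, so it lifts because `Q` is
free over itself. -/
theorem subsingleton_ext_leftQ_res (hepi : Epi (RingCat.ofHom φ)) (hflat : IsFlat R (leftQ φ))
    (N : ModuleCat.{u} Q) : Subsingleton (Abelian.Ext (leftQ φ) (res φ N) 1) := by
  let j := toRegularDual (Q := Q) N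
  let T : ShortComplex (ModuleCat.{u} Q) :=
    ModuleCat.shortComplexOfCompEqZero j (LinearMap.range j).mkQ (LinearMap.range_mkQ_comp j)
  have hT : T.ShortExact := ModuleCat.shortComplex_shortExact T
    (LinearMap.exact_map_mkQ_range j) (toRegularDual_injective N) (Submodule.mkQ_surjective _)
  refine subsingleton_ext_one_of_exists_lift (shortExact_res φ hT) (leftQ φ)
    (subsingleton_ext_regularDual φ hflat _) fun f => ?_
  let f' : Q →ₗ[Q] T.X₃ := homOfRes hepi (A := ModuleCat.of Q Q) f
  obtain ⟨t, ht⟩ := hT.moduleCat_surjective_g (f' 1)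
  refine ⟨(ModuleCat.restrictScalars φ).map (X := ModuleCat.of Q Q)
    (ModuleCat.ofHom (LinearMap.toSpanSingleton Q T.X₂ t)), ?_⟩
  refine ModuleCat.hom_ext (LinearMap.ext fun (q : Q) => ?_)
  have h : T.g.hom (q • t) = f' q := by
    rw [map_smul]
    refine (congrArg (q • ·) ht).trans ?_
    rw [← map_smul, smul_eq_mul, mul_one]
  exact h

theorem StronglyFlat.exists_lift (hepi : Epi (RingCat.ofHom φ)) (hflat : IsFlat R (leftQ φ))
    {S : ModuleCat.{u} R} (hS : StronglyFlat φ S) {E M : ModuleCat.{u} Q} (p : E →ₗ[Q] M)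
    (hp : Function.Surjective p) (f : S ⟶ res φ M) :
    ∃ g : S ⟶ res φ E, ∀ s, p (g.hom s) = f.hom s := by
  obtain ⟨g, hg⟩ := exists_lift_of_subsingleton_ext_one
    (shortExact_res φ (LinearMap.shortExact_shortComplexKer hp)) S
    (hS _ (subsingleton_ext_leftQ_res hepi hflat _)) f
  exact ⟨g, fun s => congrArg (fun h => h.hom s) hg⟩

theorem stronglyFlat_finsupp (X : Type u) : StronglyFlat φ (res φ (ModuleCat.of Q (X →₀ Q))) := by
  intro C hC
  -- Embedding `C` in an injective reduces the vanishing to a lifting problem, solved on each copy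
  -- of `Q` separately.
  let T : ShortComplex (ModuleCat.{u} R) :=
    ShortComplex.mk (Injective.ι C) (Limits.cokernel.π (Injective.ι C)) (Limits.cokernel.condition _)
  have hT : T.ShortExact := { exact := ShortComplex.exact_cokernel _ }
  have : Injective T.X₂ := inferInstanceAs (Injective (Injective.under C))
  refine subsingleton_ext_one_of_exists_lift hT _ (Abelian.Ext.subsingleton_of_injective _ _ 0)
    fun f => ?_
  let incl (x : X) : leftQ φ ⟶ res φ (ModuleCat.of Q (X →₀ Q)) :=
    (ModuleCat.restrictScalars φ).map (ModuleCat.ofHom (Finsupp.lsingle x))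
  choose g hg using fun x => exists_lift_of_subsingleton_ext_one hT (leftQ φ) hC (incl x ≫ f)
  let G : (X →₀ Q) →+ T.X₂ := Finsupp.liftAddHom fun x => (g x).hom.toAddMonoidHom
  have hG (x : X) (q : Q) : G (Finsupp.single x q) = (g x).hom q :=
    Finsupp.liftAddHom_apply_single _ _ _
  refine ⟨ModuleCat.ofHom (X := res φ (ModuleCat.of Q (X →₀ Q)))
    { toFun := G
      map_add' := G.map_add
      map_smul' := fun r v => ?_ }, ?_⟩
  · change G (φ r • (show X →₀ Q from v)) = r • G v
    induction (show X →₀ Q from v) using Finsupp.induction_linear with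
    | zero => rw [smul_zero, map_zero, smul_zero]
    | add v w hv hw => rw [smul_add, map_add, map_add, smul_add, hv, hw]
    | single x q =>
      rw [Finsupp.smul_single, hG, hG]
      exact (g x).hom.map_smul r q
  · ext v
    change T.g.hom (G v) = f.hom v
    have h : T.g.hom.toAddMonoidHom.comp G = (show (X →₀ Q) →+ T.X₃ from f.hom.toAddMonoidHom) := by
      refine Finsupp.addHom_ext fun x q => ?_
      change T.g.hom (G (Finsupp.single x q)) = _
      rw [hG]
      exact congrArg (fun h => h.hom q) (hg x)
    exact DFunLike.congr_fun h v

theorem exists_isProjectiveCover (hepi : Epi (RingCat.ofHom φ)) (hflat : IsFlat R (leftQ φ))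
    (M : ModuleCat.{u} Q) {S : ModuleCat.{u} R} (f : S ⟶ res φ M)
    (hf : IsCover (StronglyFlat φ) f) :
    ∃ (P : Type u) (_ : AddCommGroup P) (_ : Module Q P) (π : P →ₗ[Q] M),
      IsProjectiveCover Q π := by
  obtain ⟨⟨hS, hpre⟩, hauto⟩ := hf
  let F : ModuleCat.{u} Q := ModuleCat.of Q (M →₀ Q)
  let π : F →ₗ[Q] M := Finsupp.linearCombination Q id
  have hπ : Function.Surjective π := Finsupp.linearCombination_id_surjective Q M
  obtain ⟨g, hg⟩ := hpre (res φ F) ((ModuleCat.restrictScalars φ).map (ModuleCat.ofHom π))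
    (stronglyFlat_finsupp M)
  obtain ⟨i, hi⟩ := StronglyFlat.exists_lift hepi hflat hS π hπ f
  have hiso : IsIso (i ≫ g) := hauto _ (by
    ext s
    exact (congrArg (fun h => h.hom (i.hom s)) hg).trans (hi s))
  let g₀ : F → S := fun x => g.hom x
  let i₀ : S → F := fun s => i.hom s
  let v : S → S := fun s => (inv (i ≫ g)).hom s
  have hg₀ (x : F) : f.hom (g₀ x) = π x := congrArg (fun h => h.hom x) hg
  have hinv (s : S) : v (g₀ (i₀ s)) = s := congrArg (fun h => h.hom s) (IsIso.hom_inv_id (i ≫ g))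
  have hinv' (s : S) : g₀ (i₀ (v s)) = s := congrArg (fun h => h.hom s) (IsIso.inv_hom_id (i ≫ g))
  -- Idempotent projection of `F` onto the copy of `S` embedded by `i`.
  let e : F →ₗ[Q] F := homOfRes hepi (g ≫ inv (i ≫ g) ≫ i)
  have he (x : F) : e x = i₀ (v (g₀ x)) := rfl
  have hπe (x : F) : π (e x) = π x := by
    rw [he, ← hg₀ (i₀ _), hinv', hg₀]
  have hee (x : F) : e (e x) = e x := by rw [he x, he, hinv]
  let P := LinearMap.range e
  refine ⟨P, inferInstance, inferInstance, π.comp P.subtype, ?_, ?_, ?_⟩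
  · have : Module.Projective Q F := inferInstanceAs (Module.Projective Q (M →₀ Q))
    refine Module.Projective.of_split P.subtype e.rangeRestrict (LinearMap.ext ?_)
    rintro ⟨_, x, rfl⟩
    exact Subtype.ext (hee x)
  · intro m
    obtain ⟨x, rfl⟩ := hπ m
    exact ⟨⟨e x, x, rfl⟩, hπe x⟩
  · intro H hH
    have hsurj : Function.Surjective ((π.comp P.subtype).comp H.subtype) := by
      intro m
      obtain ⟨x, rfl⟩ := hπ m
      obtain ⟨a, ha, b, hb, hab⟩ := Submodule.mem_sup.1
        (hH ▸ Submodule.mem_top : (⟨e x, x, rfl⟩ : P) ∈ LinearMap.ker (π.comp P.subtype) ⊔ H)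
      refine ⟨⟨b, hb⟩, ?_⟩
      have h := congrArg (π.comp P.subtype) hab
      rw [map_add, LinearMap.mem_ker.1 ha, zero_add] at h
      exact h.trans (hπe x)
    have : Module.Projective Q F := inferInstanceAs (Module.Projective Q (M →₀ Q))
    obtain ⟨k, hk⟩ := Module.projective_lifting_property _ π hsurj
    let k' : F →ₗ[Q] F := P.subtype.comp (H.subtype.comp k)
    have hk' (x : F) : π (k' x) = π x := LinearMap.congr_fun hk x
    have hek' (x : F) : e (k' x) = k' x := by
      obtain ⟨y, hy⟩ := ((k x : H) : P).2
      change e ((k x : H) : P) = ((k x : H) : P)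
      rw [← hy, hee]
    -- This endomorphism over `M` passes through `H`. Its surjectivity puts every element of `P` in
    -- `H`, as `e` fixes the image of `k'` and `e x` depends only on `g₀ x`.
    let c : S ⟶ S := i ≫ (ModuleCat.restrictScalars φ).map (ModuleCat.ofHom k') ≫ g
    have hc : IsIso c := hauto _ (by
      ext s
      exact (hg₀ (k' (i₀ s))).trans ((hk' (i₀ s)).trans (hi s)))
    refine (Submodule.eq_top_iff').2 ?_
    rintro ⟨_, x, rfl⟩
    obtain ⟨s, hs⟩ := (ConcreteCategory.bijective_of_isIso c).2 (g₀ x)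
    have hs' : g₀ (k' (i₀ s)) = g₀ x := hs
    have h : e x = k' (i₀ s) := by rw [← hek', he, he, hs']
    have hmem : (⟨e x, x, rfl⟩ : P) = (k (i₀ s) : H) := Subtype.ext h
    rw [hmem]
    exact (k (i₀ s)).2

end Perpendicular

end NCModule

theorem mainTheorem3 {R Q : Type u} [Ring R] [Ring Q] (φ : R →+* Q)
    (hmono : Mono (RingCat.ofHom φ)) (hepi : Epi (RingCat.ofHom φ))
    (hflat : NCModule.IsFlat R (NCModule.leftQ φ))
    (hcover : ∀ M : ModuleCat.{u} Q, ∃ (S : ModuleCat.{u} R) (f : S ⟶ NCModule.res φ M),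
      NCModule.IsCover (NCModule.StronglyFlat φ) f) :
    NCModule.IsLeftPerfect Q := by
  intro M _ _
  obtain ⟨S, f, hf⟩ := hcover (ModuleCat.of Q M)
  exact NCModule.exists_isProjectiveCover hepi hflat (ModuleCat.of Q M) f hf
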